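/- For $d \ge 1$ let $S_{d-1}$ be the unit sphere of $\mathbb{R}^d$. A spherical code of angle $\theta$ in dimension $d$ is a finite set of points of $S_{d-1}$ with $\langle x, y\rangle \le \cos\theta$ for all distinct points $x,y$ of the set, and $A(d,\theta)$ denotes the largest size of such a code. Let $s_d(\theta)$ be the surface area of a spherical cap $\{y \in S_{d-1} : \langle x, y\rangle \ge \cos\theta\}$, $x \in S_{d-1}$, divided by the surface area of $S_{d-1}$ (it does not depend on $x$). For $\theta \in (0,\pi/2)$ put $$q(\theta) = \arcsin\left(\frac{\sqrt{(\cos\theta-1)^2(1+2\cos\theta)}}{\sin\theta}\right), \qquad c_\theta = \log\left(\frac{\sin\theta}{\sin q(\theta)}\right).$$ Theorem. Let $\theta \in (0,\pi/2)$ be fixed. Then $$c_\theta = \log\frac{\sin^2\theta}{\sqrt{(1-\cos\theta)^2(1+2\cos\theta)}} > 0,$$ and $$A(d,\theta) \ge (1+o(1))\,\frac{c_\theta\cdot d}{s_d(\theta)} \qquad\text{as } d\to\infty.$$ -/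

import Mathlib

open MeasureTheory Filter Topology

noncomputable section

namespace SphericalCode

/-- The unit sphere `S_{d-1}` of the Euclidean space `ℝ^d`. -/
abbrev UnitSphere (d : ℕ) : Type :=
  Metric.sphere (0 : EuclideanSpace ℝ (Fin d)) 1

/-- A finite set `C` of unit vectors of `ℝ^d` is a spherical code of angle `θ` if
`⟨x, y⟩ ≤ cos θ` for all distinct `x, y ∈ C`. -/
def IsSphericalCode {d : ℕ} (θ : ℝ) (C : Finset (UnitSphere d)) : Prop :=
  ∀ x ∈ C, ∀ y ∈ C, x ≠ y →
    inner ℝ (x : EuclideanSpace ℝ (Fin d)) (y : EuclideanSpace ℝ (Fin d)) ≤ Real.cos θ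

/-- `A(d, θ)`: the size of the largest spherical code of angle `θ` in dimension `d`.
For `θ ∈ (0, π]` this is a maximum, see `isGreatest_maxCodeSize`. -/
def maxCodeSize (d : ℕ) (θ : ℝ) : ℕ :=
  sSup {k : ℕ | ∃ C : Finset (UnitSphere d), IsSphericalCode θ C ∧ C.card = k}

/-- The sizes of spherical codes of angle `θ ∈ (0, π]` in a given dimension are bounded, so that
the supremum in the definition of `A(d, θ)` is attained. -/
theorem isGreatest_maxCodeSize (d : ℕ) {θ : ℝ} (h0 : 0 < θ) (hpi : θ ≤ Real.pi) :
    IsGreatest {k : ℕ | ∃ C : Finset (UnitSphere d), IsSphericalCode θ C ∧ C.card = k}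
      (maxCodeSize d θ) := by
  have hcos : Real.cos θ < 1 := by
    have := Real.cos_lt_cos_of_nonneg_of_le_pi le_rfl hpi h0
    simpa using this
  set r : ℝ := Real.sqrt (2 - 2 * Real.cos θ) with hr
  have hrpos : 0 < r := Real.sqrt_pos.mpr (by linarith)
  obtain ⟨t, -, htf, ht⟩ := Metric.totallyBounded_iff.mp
    (isCompact_univ (X := UnitSphere d)).totallyBounded (r / 2) (by positivity) |>.imp
      (fun t ht => (⟨trivial, ht.1, ht.2⟩ : True ∧ _ ∧ _))
  have hbdd : BddAbove
      {k : ℕ | ∃ C : Finset (UnitSphere d), IsSphericalCode θ C ∧ C.card = k} := by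
    refine ⟨htf.toFinset.card, ?_⟩
    rintro k ⟨C, hC, rfl⟩
    have hex : ∀ x : UnitSphere d, ∃ y ∈ t, dist x y < r / 2 := by
      intro x
      have := ht (Set.mem_univ x)
      simpa using this
    choose f hft hfd using hex
    refine Finset.card_le_card_of_injOn f (fun x _ => by simpa using hft x) ?_
    intro x hx y hy hxy
    by_contra hne
    have h1 : dist x y < r := by
      have hx' := hfd x
      have hy' := hfd y
      rw [← hxy] at hy'
      have := dist_triangle_right x y (f x)
      linarith
    have h2 := hC x hx y hy hne
    have h3 : dist x y ^ 2 = 2 - 2 *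
        inner ℝ (x : EuclideanSpace ℝ (Fin d)) (y : EuclideanSpace ℝ (Fin d)) := by
      rw [Subtype.dist_eq, dist_eq_norm, norm_sub_sq_real, norm_eq_of_mem_sphere x,
        norm_eq_of_mem_sphere y]
      ring
    have h4 : r ^ 2 = 2 - 2 * Real.cos θ := Real.sq_sqrt (by linarith)
    have h5 : dist x y ^ 2 < r ^ 2 := by
      have := dist_nonneg (x := x) (y := y)
      gcongr
    linarith
  refine ⟨Nat.sSup_mem ⟨0, ∅, ?_, rfl⟩ hbdd, fun k hk => le_csSup hbdd hk⟩
  intro x hx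
  simp at hx

/-- The normalized surface area `s(A)` of a set `A ⊆ S_{d-1}`: the surface area of `A` divided by
the surface area of the whole sphere. -/
def normalizedArea {d : ℕ} (A : Set (UnitSphere d)) : ℝ :=
  ((volume : Measure (EuclideanSpace ℝ (Fin d))).toSphere).real A /
    ((volume : Measure (EuclideanSpace ℝ (Fin d))).toSphere).real Set.univ

/-- The spherical cap `C_θ(x) = {y ∈ S_{d-1} : ⟨x, y⟩ ≥ cos θ}` of angular radius `θ`
around `x`. -/
def cap {d : ℕ} (θ : ℝ) (x : UnitSphere d) : Set (UnitSphere d) :=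
  {y | Real.cos θ ≤
    inner ℝ (x : EuclideanSpace ℝ (Fin d)) (y : EuclideanSpace ℝ (Fin d))}

/-- The angle `q(θ) = arcsin (√((cos θ - 1)² (1 + 2 cos θ)) / sin θ)`. -/
def q (θ : ℝ) : ℝ :=
  Real.arcsin (Real.sqrt ((Real.cos θ - 1) ^ 2 * (1 + 2 * Real.cos θ)) / Real.sin θ)

/-- The constant `c_θ = log (sin θ / sin q(θ))`. -/
def codeConst (θ : ℝ) : ℝ :=
  Real.log (Real.sin θ / Real.sin (q θ))

end SphericalCode

end

/-!
The bound comes from the hard-core model: a random spherical code, drawn with fugacity `l` from a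
fine discretization of the sphere, is shown to have at least `(1 + o(1)) c_θ d / s_d(θ)` points on
average.

The discretization is a finite weighted graph of total weight `1`: its vertices are the values of
a simple function that moves no point by more than `ε`, the weight of a vertex is the area
rounded to it, and two vertices are adjacent if their angle is less than `θ`. Its independent sets
are spherical codes, closed neighbourhoods have weight at most `D`, slightly above `s_d(θ)`, and by
`exists_midpoint_cap` they are locally sparse: if `u` lies in the cap around `v`, then the points
that are within `θ` of `u` and at least as close to `v` as `u` lie in a cap of angular radius
`q(θ)` around the midpoint of `u` and `v`. So every subset of a closed neighbourhood has an
average inner degree of at most `2 Δ`, with `Δ` an upper bound for the area of a cap of angular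
radius `q(θ)`.

For a vertex `v`, condition on the random code outside the closed neighbourhood `N` of `v`. Inside
`N` it is again a hard-core model, on some `T ⊆ N`, with partition function `Z`. It misses `N`
with probability `1 / Z`, and by local sparsity it has at least `(1 - 2 l Δ) log Z` points in `N`
on average (`mul_log_hcZ_le_hcSize`). If `Z` is small, the first fact yields many points, since a
vertex `v` is chosen with `l w(v)` times the probability that `N` is missed; if `Z` is large, the
second does. The inequality `exp (k - log Z) ≥ 1 + k - log Z` combines the two into a bound that
can be averaged over `v` (`one_add_le_mul_of_independent_card_le`).

Finally `l = 1 / (d Δ)` makes `l Δ` negligible and, with `exp k = l D / d`, gives a code of size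
about `log (s_d(θ) / Δ) / s_d(θ)`. To exponential order the area of a cap of angular radius `φ` is
`(sin φ) ^ d` (`normalizedArea_capAtLeast_le`, `eventually_le_log_normalizedArea`), so the
logarithm is `c_θ d` up to `o(d)`.
-/

namespace SphericalCode

/-! ### The hard-core model on a finite graph -/

/-- If `p` orders `B` so that every closed neighbourhood has weight at most `Δ` above its centre,
then every subset of `B` is sparse. -/
theorem sum_mul_sum_le_of_order {ι : Type*} {R : ι → ι → Prop} [DecidableRel R]
    (hs : ∀ x y, R x y → R y x) {w : ι → ℝ} (hw : ∀ v, 0 ≤ w v)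
    {Δ : ℝ} {B : Finset ι} (p : ι → ℝ)
    (hp : ∀ u ∈ B, ∑ x ∈ B with R u x ∧ p u ≤ p x, w x ≤ Δ) {T : Finset ι} (hT : T ⊆ B) :
    ∑ u ∈ T, w u * ∑ x ∈ T with R u x, w x ≤ 2 * Δ * ∑ u ∈ T, w u := by
  have h1 : ∑ u ∈ T, ∑ x ∈ T, (if R u x ∧ p u ≤ p x then w u * w x else 0) ≤
      Δ * ∑ u ∈ T, w u := by
    rw [Finset.mul_sum]
    refine Finset.sum_le_sum fun u hu => ?_
    rw [← Finset.sum_filter, ← Finset.mul_sum, mul_comm]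
    refine mul_le_mul_of_nonneg_right (le_trans ?_ (hp u (hT hu))) (hw u)
    exact Finset.sum_le_sum_of_subset_of_nonneg (Finset.filter_subset_filter _ hT)
      fun x _ _ => hw x
  have h2 : ∑ u ∈ T, ∑ x ∈ T, (if R u x ∧ p x ≤ p u then w u * w x else 0) ≤
      Δ * ∑ u ∈ T, w u := by
    rw [Finset.sum_comm]
    refine le_trans (le_of_eq ?_) h1
    refine Finset.sum_congr rfl fun u _ => Finset.sum_congr rfl fun x _ => ?_
    simp only [mul_comm (w x), show R x u ↔ R u x from ⟨hs _ _, hs _ _⟩]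
  have h3 : ∑ u ∈ T, w u * ∑ x ∈ T with R u x, w x ≤
      ∑ u ∈ T, ∑ x ∈ T, (if R u x ∧ p u ≤ p x then w u * w x else 0) +
      ∑ u ∈ T, ∑ x ∈ T, (if R u x ∧ p x ≤ p u then w u * w x else 0) := by
    rw [← Finset.sum_add_distrib]
    refine Finset.sum_le_sum fun u _ => ?_
    rw [← Finset.sum_add_distrib, Finset.mul_sum, Finset.sum_filter]
    refine Finset.sum_le_sum fun x _ => ?_
    have h := mul_nonneg (hw u) (hw x)
    by_cases hR : R u x
    · rcases le_total (p u) (p x) with h' | h' <;> simp only [hR, h', true_and, if_true] <;>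
        split_ifs <;> linarith
    · simp [hR]
  linarith

section HardCore

variable {ι : Type*} [DecidableEq ι] (R : ι → ι → Prop) [DecidableRel R] (f : ι → ℝ)

/-- The weight of a finite set `I` in the hard-core model with conflict relation `R` and
fugacities `f`: the product of the fugacities if no two distinct elements of `I` are in conflict,
and `0` otherwise. -/
def hcWeight (I : Finset ι) : ℝ :=
  if ∀ x ∈ I, ∀ y ∈ I, x ≠ y → ¬ R x y then ∏ v ∈ I, f v else 0

/-- The partition function of the hard-core model on the vertex set `A`. -/
def hcZ (A : Finset ι) : ℝ := ∑ I ∈ A.powerset, hcWeight R f I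

/-- The expected size of a random set of the hard-core model on `A`, times the partition
function. -/
def hcSize (A : Finset ι) : ℝ := ∑ I ∈ A.powerset, hcWeight R f I * (I.card : ℝ)

variable {R f}

theorem hcWeight_nonneg (hf : ∀ v, 0 ≤ f v) (I : Finset ι) : 0 ≤ hcWeight R f I := by
  unfold hcWeight
  split_ifs
  · exact Finset.prod_nonneg fun v _ => hf v
  · exact le_rfl

theorem hcWeight_empty : hcWeight R f ∅ = 1 := by simp [hcWeight]

theorem hcWeight_le_prod (hf : ∀ v, 0 ≤ f v) (I : Finset ι) :
    hcWeight R f I ≤ ∏ v ∈ I, f v := by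
  unfold hcWeight
  split_ifs
  · exact le_rfl
  · exact Finset.prod_nonneg fun v _ => hf v

theorem one_le_hcZ (hf : ∀ v, 0 ≤ f v) (A : Finset ι) : 1 ≤ hcZ R f A := by
  unfold hcZ
  rw [← hcWeight_empty (R := R) (f := f)]
  exact Finset.single_le_sum (f := hcWeight R f) (fun I _ => hcWeight_nonneg hf I)
    (Finset.empty_mem_powerset A)

theorem hcZ_pos (hf : ∀ v, 0 ≤ f v) (A : Finset ι) : 0 < hcZ R f A :=
  zero_lt_one.trans_le (one_le_hcZ hf A)

theorem hcZ_le_exp (hf : ∀ v, 0 ≤ f v) (A : Finset ι) :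
    hcZ R f A ≤ Real.exp (∑ v ∈ A, f v) := by
  calc hcZ R f A ≤ ∑ I ∈ A.powerset, ∏ v ∈ I, f v :=
        Finset.sum_le_sum fun I _ => hcWeight_le_prod hf I
    _ = ∏ v ∈ A, (1 + f v) := (Finset.prod_one_add A).symm
    _ ≤ ∏ v ∈ A, Real.exp (f v) :=
        Finset.prod_le_prod (fun v _ => by linarith [hf v]) fun v _ => by
          linarith [Real.add_one_le_exp (f v)]
    _ = Real.exp (∑ v ∈ A, f v) := (Real.exp_sum A f).symm

/-- A subset of a disjoint union is a pair of subsets of the parts. -/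
theorem sum_powerset_union {A B : Finset ι} (h : Disjoint A B) (g : Finset ι → ℝ) :
    ∑ I ∈ (A ∪ B).powerset, g I = ∑ J ∈ A.powerset, ∑ K ∈ B.powerset, g (J ∪ K) := by
  rw [← Finset.sum_product']
  symm
  refine Finset.sum_bij' (fun p _ => p.1 ∪ p.2) (fun I _ => (I ∩ A, I ∩ B)) ?_ ?_ ?_ ?_ ?_
  · intro p hp
    simp only [Finset.mem_product, Finset.mem_powerset] at hp ⊢
    exact Finset.union_subset_union hp.1 hp.2
  · intro I _
    simp [Finset.inter_subset_right]
  · rintro ⟨J, K⟩ hp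
    simp only [Finset.mem_product, Finset.mem_powerset] at hp
    rw [Finset.disjoint_left] at h
    ext x
    · have h1 := @hp.1 x; have h2 := @hp.2 x; have h3 := @h x
      simp only [Finset.mem_inter, Finset.mem_union]; tauto
    · have h1 := @hp.1 x; have h2 := @hp.2 x; have h3 := @h x
      simp only [Finset.mem_inter, Finset.mem_union]; tauto
  · intro I hI
    rw [Finset.mem_powerset] at hI
    rw [← Finset.inter_union_distrib_left]
    exact Finset.inter_eq_left.mpr hI
  · intro p _
    rfl

/-- Given the part `J` of an independent set outside `B`, its part in `B` ranges over the
independent subsets of the vertices of `B` without a conflict with `J`. -/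
theorem hcWeight_union (hs : ∀ x y, R x y → R y x) {J K : Finset ι} (h : Disjoint J K) :
    hcWeight R f (J ∪ K) =
      if ∀ x ∈ K, ∀ y ∈ J, ¬ R y x then hcWeight R f J * hcWeight R f K else 0 := by
  unfold hcWeight
  rw [Finset.prod_union h]
  have key : (∀ x ∈ J ∪ K, ∀ y ∈ J ∪ K, x ≠ y → ¬ R x y) ↔
      (∀ x ∈ K, ∀ y ∈ J, ¬ R y x) ∧ (∀ x ∈ J, ∀ y ∈ J, x ≠ y → ¬ R x y) ∧
        ∀ x ∈ K, ∀ y ∈ K, x ≠ y → ¬ R x y := by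
    constructor
    · intro H
      refine ⟨fun x hx y hy => H y (by simp [hy]) x (by simp [hx]) ?_,
        fun x hx y hy => H x (by simp [hx]) y (by simp [hy]),
        fun x hx y hy => H x (by simp [hx]) y (by simp [hy])⟩
      rintro rfl
      exact Finset.disjoint_left.mp h hy hx
    · rintro ⟨h1, h2, h3⟩ x hx y hy hxy
      rw [Finset.mem_union] at hx hy
      rcases hx with hx | hx <;> rcases hy with hy | hy
      · exact h2 x hx y hy hxy
      · exact h1 y hy x hx
      · exact fun hr => h1 x hx y hy (hs _ _ hr)
      · exact h3 x hx y hy hxy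
  by_cases h1 : ∀ x ∈ K, ∀ y ∈ J, ¬ R y x
  · by_cases h2 : ∀ x ∈ J, ∀ y ∈ J, x ≠ y → ¬ R x y
    · by_cases h3 : ∀ x ∈ K, ∀ y ∈ K, x ≠ y → ¬ R x y
      · rw [if_pos (key.mpr ⟨h1, h2, h3⟩), if_pos h1, if_pos h2, if_pos h3]
      · rw [if_neg (fun H => h3 (key.mp H).2.2), if_pos h1, if_neg h3, mul_zero]
    · rw [if_neg (fun H => h2 (key.mp H).2.1), if_pos h1, if_neg h2, zero_mul]
  · rw [if_neg (fun H => h1 (key.mp H).1), if_neg h1]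

/-- The spatial Markov property of the hard-core model. -/
theorem sum_hcWeight_union (hs : ∀ x y, R x y → R y x) {A B : Finset ι} (h : Disjoint A B)
    (g : Finset ι → ℝ) :
    ∑ I ∈ (A ∪ B).powerset, hcWeight R f I * g I =
      ∑ J ∈ A.powerset, hcWeight R f J *
        ∑ K ∈ (B.filter fun x => ∀ y ∈ J, ¬ R y x).powerset, hcWeight R f K * g (J ∪ K) := by
  rw [sum_powerset_union h]
  refine Finset.sum_congr rfl fun J hJ => ?_
  rw [Finset.mem_powerset] at hJ
  rw [Finset.mul_sum]
  symm
  refine Finset.sum_subset_zero_on_sdiff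
    (Finset.powerset_mono.mpr (Finset.filter_subset _ B)) ?_ ?_
  · intro K hK
    rw [Finset.mem_sdiff, Finset.mem_powerset, Finset.mem_powerset] at hK
    rw [hcWeight_union hs (Finset.disjoint_of_subset_left hJ
      (Finset.disjoint_of_subset_right hK.1 h)), if_neg, zero_mul]
    intro H
    exact hK.2 fun x hx => Finset.mem_filter.mpr ⟨hK.1 hx, H x hx⟩
  · intro K hK
    rw [Finset.mem_powerset] at hK
    have hKB : K ⊆ B := hK.trans (Finset.filter_subset _ B)
    rw [hcWeight_union hs (Finset.disjoint_of_subset_left hJ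
      (Finset.disjoint_of_subset_right hKB h)), if_pos, mul_assoc]
    intro x hx
    exact (Finset.mem_filter.mp (hK hx)).2

theorem hcZ_union (hs : ∀ x y, R x y → R y x) {A B : Finset ι} (h : Disjoint A B) :
    hcZ R f (A ∪ B) =
      ∑ J ∈ A.powerset, hcWeight R f J * hcZ R f (B.filter fun x => ∀ y ∈ J, ¬ R y x) := by
  have := sum_hcWeight_union (f := f) hs h (fun _ => 1)
  simpa [hcZ] using this

theorem hcZ_mono (hf : ∀ v, 0 ≤ f v) {A B : Finset ι} (h : A ⊆ B) : hcZ R f A ≤ hcZ R f B :=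
  Finset.sum_le_sum_of_subset_of_nonneg (Finset.powerset_mono.mpr h)
    fun I _ _ => hcWeight_nonneg hf I

theorem hcZ_union_le (hf : ∀ v, 0 ≤ f v) (hs : ∀ x y, R x y → R y x) {A B : Finset ι}
    (h : Disjoint A B) : hcZ R f (A ∪ B) ≤ hcZ R f A * hcZ R f B := by
  rw [hcZ_union hs h, hcZ, Finset.sum_mul]
  exact Finset.sum_le_sum fun J _ =>
    mul_le_mul_of_nonneg_left (hcZ_mono hf (Finset.filter_subset _ B)) (hcWeight_nonneg hf J)

/-- An independent set that contains `u` is `u` together with an independent set avoiding the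
closed neighbourhood of `u`. -/
theorem sum_hcWeight_mem (hr : ∀ x, R x x) (hs : ∀ x y, R x y → R y x) {A : Finset ι} {u : ι}
    (hu : u ∈ A) :
    ∑ I ∈ A.powerset, (if u ∈ I then hcWeight R f I else 0) =
      f u * hcZ R f (A.filter fun x => ¬ R u x) := by
  have hA : {u} ∪ A.erase u = A := by
    rw [← Finset.insert_eq, Finset.insert_erase hu]
  have hd : Disjoint {u} (A.erase u) := by simp
  have h := sum_hcWeight_union (f := f) hs hd (fun I => if u ∈ I then 1 else 0)
  rw [hA] at h
  simp only [mul_ite, mul_one, mul_zero] at h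
  rw [h]
  have hw : hcWeight R f {u} = f u := by simp [hcWeight]
  have he : (A.erase u).filter (fun x => ¬ R u x) = A.filter fun x => ¬ R u x := by
    ext x
    simp only [Finset.mem_filter, Finset.mem_erase]
    constructor
    · rintro ⟨⟨_, h1⟩, h2⟩; exact ⟨h1, h2⟩
    · rintro ⟨h1, h2⟩
      exact ⟨⟨fun hx => h2 (hx ▸ hr _), h1⟩, h2⟩
  have hp : ({u} : Finset ι).powerset = {∅, {u}} := by
    ext x; simp [Finset.subset_singleton_iff]
  rw [hp, Finset.sum_pair (by simp)]
  have hz : ∑ K ∈ ((A.erase u).filter fun x => ∀ y ∈ (∅ : Finset ι), ¬ R y x).powerset,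
      (if u ∈ ∅ ∪ K then hcWeight R f K else 0) = 0 := by
    refine Finset.sum_eq_zero fun K hK => ?_
    rw [Finset.mem_powerset] at hK
    rw [if_neg]
    rw [Finset.empty_union]
    intro hK'
    simpa using hK hK'
  rw [hz, hw]
  simp [hcZ, he]

theorem hcSize_eq (hr : ∀ x, R x x) (hs : ∀ x y, R x y → R y x) (A : Finset ι) :
    hcSize R f A = ∑ u ∈ A, f u * hcZ R f (A.filter fun x => ¬ R u x) := by
  have h1 : ∀ I ∈ A.powerset, hcWeight R f I * (I.card : ℝ) =
      ∑ u ∈ A, if u ∈ I then hcWeight R f I else 0 := by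
    intro I hI
    rw [Finset.mem_powerset] at hI
    rw [← Finset.sum_filter, Finset.filter_mem_eq_inter, Finset.inter_eq_right.mpr hI,
      Finset.sum_const, nsmul_eq_mul, mul_comm]
  rw [hcSize, Finset.sum_congr rfl h1, Finset.sum_comm]
  exact Finset.sum_congr rfl fun u hu => sum_hcWeight_mem hr hs hu

/-- If a vertex set `T` is sparse, in the sense that the average fugacity of the closed
neighbourhoods inside `T` is at most `ε`, then the random subset of `T` is almost as large as
`log Z_T` on average. -/
theorem mul_log_hcZ_le_hcSize (hf : ∀ v, 0 ≤ f v) (hr : ∀ x, R x x)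
    (hs : ∀ x y, R x y → R y x) {ε : ℝ} (hε : ε ≤ 1) {T : Finset ι}
    (hT : ∑ u ∈ T, f u * ∑ x ∈ T with R u x, f x ≤ ε * ∑ u ∈ T, f u) :
    (1 - ε) * (hcZ R f T * Real.log (hcZ R f T)) ≤ hcSize R f T := by
  have hZ := hcZ_pos (R := R) hf T
  have hlog : Real.log (hcZ R f T) ≤ ∑ u ∈ T, f u := by
    rw [Real.log_le_iff_le_exp hZ]
    exact hcZ_le_exp hf T
  have hlow : ∀ u ∈ T, hcZ R f T * (1 - ∑ x ∈ T with R u x, f x) ≤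
      hcZ R f (T.filter fun x => ¬ R u x) := by
    intro u _
    set N := T.filter fun x => R u x
    set M := T.filter fun x => ¬ R u x
    have h1 : hcZ R f T ≤ hcZ R f M * Real.exp (∑ x ∈ N, f x) := by
      have hd : Disjoint M N := (Finset.disjoint_filter_filter_not T T _).symm
      have hu : M ∪ N = T := by
        rw [Finset.union_comm]; exact Finset.filter_union_filter_not_eq _ T
      calc hcZ R f T = hcZ R f (M ∪ N) := by rw [hu]
        _ ≤ hcZ R f M * hcZ R f N := hcZ_union_le hf hs hd
        _ ≤ _ := mul_le_mul_of_nonneg_left (hcZ_le_exp hf N) (hcZ_pos hf M).le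
    have h2 : 1 - ∑ x ∈ N, f x ≤ Real.exp (-∑ x ∈ N, f x) := by
      linarith [Real.add_one_le_exp (-∑ x ∈ N, f x)]
    calc hcZ R f T * (1 - ∑ x ∈ N, f x) ≤ hcZ R f T * Real.exp (-∑ x ∈ N, f x) :=
          mul_le_mul_of_nonneg_left h2 hZ.le
      _ ≤ (hcZ R f M * Real.exp (∑ x ∈ N, f x)) * Real.exp (-∑ x ∈ N, f x) :=
          mul_le_mul_of_nonneg_right h1 (Real.exp_pos _).le
      _ = hcZ R f M := by rw [mul_assoc, ← Real.exp_add]; simp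
  calc (1 - ε) * (hcZ R f T * Real.log (hcZ R f T))
      ≤ (1 - ε) * (hcZ R f T * ∑ u ∈ T, f u) := by
        apply mul_le_mul_of_nonneg_left _ (by linarith)
        exact mul_le_mul_of_nonneg_left hlog hZ.le
    _ = hcZ R f T * (∑ u ∈ T, f u - ε * ∑ u ∈ T, f u) := by ring
    _ ≤ hcZ R f T * (∑ u ∈ T, f u - ∑ u ∈ T, f u * ∑ x ∈ T with R u x, f x) := by
        apply mul_le_mul_of_nonneg_left _ hZ.le
        linarith
    _ = ∑ u ∈ T, f u * (hcZ R f T * (1 - ∑ x ∈ T with R u x, f x)) := by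
        rw [← Finset.sum_sub_distrib, Finset.mul_sum]
        exact Finset.sum_congr rfl fun u _ => by ring
    _ ≤ ∑ u ∈ T, f u * hcZ R f (T.filter fun x => ¬ R u x) :=
        Finset.sum_le_sum fun u hu => mul_le_mul_of_nonneg_left (hlow u hu) (hf u)
    _ = hcSize R f T := (hcSize_eq hr hs T).symm

/-- The trade-off at a single vertex `v`, with `B` its closed neighbourhood: either the random
independent set avoids `B` with good probability, or it meets `B` in many points on average. -/
theorem hcZ_le_local (hf : ∀ v, 0 ≤ f v) (hr : ∀ x, R x x)
    (hs : ∀ x y, R x y → R y x) {ε : ℝ} (hε : ε < 1) (k : ℝ) {A B : Finset ι} (hd : Disjoint A B)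
    (hB : ∀ T ⊆ B, ∑ u ∈ T, f u * ∑ x ∈ T with R u x, f x ≤ ε * ∑ u ∈ T, f u) :
    (1 + k) * hcZ R f (A ∪ B) ≤ Real.exp k * hcZ R f A +
      (1 - ε)⁻¹ * ∑ I ∈ (A ∪ B).powerset, hcWeight R f I * ((I ∩ B).card : ℝ) := by
  have hε' : 0 < 1 - ε := by linarith
  have hZ : ∀ T : Finset ι, T ⊆ B → (1 + k) * hcZ R f T ≤
      Real.exp k + (1 - ε)⁻¹ * hcSize R f T := by
    intro T hT
    have h1 := mul_log_hcZ_le_hcSize hf hr hs hε.le (hB T hT)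
    have hpos := hcZ_pos (R := R) hf T
    have h2 : hcZ R f T * Real.log (hcZ R f T) ≤ (1 - ε)⁻¹ * hcSize R f T := by
      rw [inv_mul_eq_div, le_div_iff₀ hε']
      linarith
    -- the tangent line of the exponential function at `0`
    have h3 : (1 + (k - Real.log (hcZ R f T))) * hcZ R f T ≤ Real.exp k := by
      have h4 := Real.add_one_le_exp (k - Real.log (hcZ R f T))
      rw [Real.exp_sub, Real.exp_log hpos, le_div_iff₀ hpos] at h4
      linarith
    linarith
  rw [hcZ_union hs hd, sum_hcWeight_union hs hd, Finset.mul_sum]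
  have hsum : ∀ J ∈ A.powerset, ∀ T ⊆ B,
      ∑ K ∈ T.powerset, hcWeight R f K * (((J ∪ K) ∩ B).card : ℝ) = hcSize R f T := by
    intro J hJ T hT
    refine Finset.sum_congr rfl fun K hK => ?_
    rw [Finset.mem_powerset] at hJ hK
    rw [Finset.union_inter_distrib_right, Finset.inter_eq_left.mpr (hK.trans hT),
      Finset.disjoint_iff_inter_eq_empty.mp (Finset.disjoint_of_subset_left hJ hd),
      Finset.empty_union]
  rw [hcZ, Finset.mul_sum, Finset.mul_sum, ← Finset.sum_add_distrib]
  refine Finset.sum_le_sum fun J hJ => ?_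
  rw [hsum J hJ _ (Finset.filter_subset _ B)]
  have h5 := mul_le_mul_of_nonneg_left
    (hZ _ (Finset.filter_subset (fun x => ∀ y ∈ J, ¬ R y x) B)) (hcWeight_nonneg (R := R) hf J)
  linarith

/-- A weighted finite graph (with closed adjacency `R`) of total weight `1`, in which closed
neighbourhoods have weight at most `D` and are locally sparse with parameter `Δ`, has large
independent sets: a bound `M` on their sizes cannot be small. Here `l` is the fugacity, and `k`,
a guess for the typical value of `log Z` on a closed neighbourhood, is free. -/
theorem one_add_le_mul_of_independent_card_le [Fintype ι] (hr : ∀ x, R x x)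
    (hs : ∀ x y, R x y → R y x)
    {w : ι → ℝ} (hw : ∀ v, 0 ≤ w v) (hw1 : ∑ v, w v = 1) {D Δ l k : ℝ} (hl : 0 < l)
    (hlΔ : 2 * l * Δ < 1) (hD : ∀ v, ∑ u with R v u, w u ≤ D)
    (hΔ : ∀ v, ∃ p : ι → ℝ, ∀ u, R v u → ∑ x with R v x ∧ R u x ∧ p u ≤ p x, w x ≤ Δ)
    {M : ℝ} (hM : ∀ I : Finset ι, (∀ x ∈ I, ∀ y ∈ I, x ≠ y → ¬ R x y) → (I.card : ℝ) ≤ M) :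
    1 + k ≤ (Real.exp k / l + D / (1 - 2 * l * Δ)) * M := by
  set f : ι → ℝ := fun v => l * w v with hfdef
  have hf : ∀ v, 0 ≤ f v := fun v => mul_nonneg hl.le (hw v)
  set Z := hcZ R f Finset.univ with hZdef
  have hZ : 0 < Z := hcZ_pos hf _
  set a := hcSize R f Finset.univ with hadef
  have hε : 0 < 1 - 2 * l * Δ := by linarith
  have ha0 : 0 ≤ a := Finset.sum_nonneg fun I _ =>
    mul_nonneg (hcWeight_nonneg hf I) (Nat.cast_nonneg _)
  have hloc : ∀ v, (1 + k) * Z ≤ Real.exp k * hcZ R f (Finset.univ.filter fun x => ¬ R v x) +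
      (1 - 2 * l * Δ)⁻¹ * ∑ I ∈ (Finset.univ : Finset ι).powerset,
        hcWeight R f I * ((I ∩ Finset.univ.filter fun x => R v x).card : ℝ) := by
    intro v
    obtain ⟨p, hp⟩ := hΔ v
    have hun : (Finset.univ.filter fun x => ¬ R v x) ∪ (Finset.univ.filter fun x => R v x) =
        Finset.univ := by
      rw [Finset.union_comm]; exact Finset.filter_union_filter_not_eq _ _
    have hd : Disjoint (Finset.univ.filter fun x => ¬ R v x)
        (Finset.univ.filter fun x => R v x) :=
      (Finset.disjoint_filter_filter_not Finset.univ Finset.univ _).symm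
    have h := hcZ_le_local (f := f) hf hr hs (ε := 2 * l * Δ) (by linarith) k hd ?_
    · rw [hun] at h
      exact h
    · intro T hT
      have h2 := sum_mul_sum_le_of_order hs hw p (Δ := Δ) ?_ hT
      · simp only [hfdef, ← Finset.mul_sum]
        calc ∑ u ∈ T, l * w u * (l * ∑ x ∈ T with R u x, w x)
            = l ^ 2 * ∑ u ∈ T, w u * ∑ x ∈ T with R u x, w x := by
              rw [Finset.mul_sum]
              exact Finset.sum_congr rfl fun u _ => by ring
          _ ≤ l ^ 2 * (2 * Δ * ∑ u ∈ T, w u) := mul_le_mul_of_nonneg_left h2 (by positivity)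
          _ = _ := by ring
      · intro u hu
        rw [Finset.filter_filter]
        exact hp u (Finset.mem_filter.mp hu).2
  -- average the local inequality over `v`, chosen with probability `w v`
  have havg : (1 + k) * Z ≤ Real.exp k / l * a + D / (1 - 2 * l * Δ) * a := by
    have h1 : ∑ v, w v * hcZ R f (Finset.univ.filter fun x => ¬ R v x) = a / l := by
      rw [hadef, hcSize_eq hr hs, Finset.sum_div]
      refine Finset.sum_congr rfl fun v _ => ?_
      simp only [hfdef]
      field_simp
    have h2 : ∑ v, w v * ∑ I ∈ (Finset.univ : Finset ι).powerset,
        hcWeight R f I * ((I ∩ Finset.univ.filter fun x => R v x).card : ℝ) ≤ D * a := by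
      have h3 : ∀ I : Finset ι,
          ∑ v, w v * ((I ∩ Finset.univ.filter fun x => R v x).card : ℝ) ≤ D * I.card := by
        intro I
        have h4 : ∀ v, w v * ((I ∩ Finset.univ.filter fun x => R v x).card : ℝ) =
            ∑ u ∈ I, if R u v then w v else 0 := by
          intro v
          have h5 : I ∩ Finset.univ.filter (fun x => R v x) = I.filter fun u => R u v := by
            ext x
            simp only [Finset.mem_inter, Finset.mem_filter, Finset.mem_univ, true_and,
              show R v x ↔ R x v from ⟨hs _ _, hs _ _⟩]
          rw [h5, ← Finset.sum_filter, Finset.sum_const, nsmul_eq_mul, mul_comm]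
        rw [Finset.sum_congr rfl fun v _ => h4 v, Finset.sum_comm]
        calc ∑ u ∈ I, ∑ v, (if R u v then w v else 0) ≤ ∑ _u ∈ I, D :=
              Finset.sum_le_sum fun u _ => by rw [← Finset.sum_filter]; exact hD u
          _ = D * I.card := by rw [Finset.sum_const, nsmul_eq_mul, mul_comm]
      simp only [Finset.mul_sum]
      rw [Finset.sum_comm, hadef, hcSize, Finset.mul_sum]
      refine Finset.sum_le_sum fun I _ => ?_
      calc ∑ v, w v * (hcWeight R f I * ((I ∩ Finset.univ.filter fun x => R v x).card : ℝ))
          = hcWeight R f I *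
            ∑ v, w v * ((I ∩ Finset.univ.filter fun x => R v x).card : ℝ) := by
            rw [Finset.mul_sum]
            exact Finset.sum_congr rfl fun v _ => by ring
        _ ≤ hcWeight R f I * (D * I.card) :=
            mul_le_mul_of_nonneg_left (h3 I) (hcWeight_nonneg hf I)
        _ = _ := by ring
    calc (1 + k) * Z = ∑ v, w v * ((1 + k) * Z) := by rw [← Finset.sum_mul, hw1, one_mul]
      _ ≤ ∑ v, w v * (Real.exp k * hcZ R f (Finset.univ.filter fun x => ¬ R v x) +
          (1 - 2 * l * Δ)⁻¹ * ∑ I ∈ (Finset.univ : Finset ι).powerset,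
            hcWeight R f I * ((I ∩ Finset.univ.filter fun x => R v x).card : ℝ)) :=
          Finset.sum_le_sum fun v _ => mul_le_mul_of_nonneg_left (hloc v) (hw v)
      _ = Real.exp k * ∑ v, w v * hcZ R f (Finset.univ.filter fun x => ¬ R v x) +
          (1 - 2 * l * Δ)⁻¹ * ∑ v, w v * ∑ I ∈ (Finset.univ : Finset ι).powerset,
            hcWeight R f I * ((I ∩ Finset.univ.filter fun x => R v x).card : ℝ) := by
          rw [Finset.mul_sum, Finset.mul_sum (a := (1 - 2 * l * Δ)⁻¹), ← Finset.sum_add_distrib]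
          exact Finset.sum_congr rfl fun v _ => by ring
      _ ≤ Real.exp k * (a / l) + (1 - 2 * l * Δ)⁻¹ * (D * a) := by
          rw [h1]
          have := mul_le_mul_of_nonneg_left h2 (inv_pos.mpr hε).le
          linarith
      _ = _ := by field_simp
  have haM : a ≤ M * Z := by
    rw [hadef, hcSize, hZdef, hcZ, Finset.mul_sum]
    refine Finset.sum_le_sum fun I _ => ?_
    rw [mul_comm M]
    by_cases hI : ∀ x ∈ I, ∀ y ∈ I, x ≠ y → ¬ R x y
    · exact mul_le_mul_of_nonneg_left (hM I hI) (hcWeight_nonneg hf I)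
    · simp [hcWeight, hI]
  have hD0 : 0 ≤ D := by
    rcases isEmpty_or_nonempty ι with h | ⟨⟨v⟩⟩
    · simp at hw1
    · exact le_trans (Finset.sum_nonneg fun u _ => hw u) (hD v)
  have hC : 0 ≤ Real.exp k / l + D / (1 - 2 * l * Δ) := by positivity
  have hfin := mul_le_mul_of_nonneg_left haM hC
  refine le_of_mul_le_mul_right ?_ hZ
  linarith

end HardCore

/-! ### The area of spherical caps -/

section CapArea

open scoped Pointwise

variable {d : ℕ}

/-- The set of points of the sphere whose inner product with `x` is at least `a`: the spherical cap
around `x` of angular radius `arccos a`. -/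
def capAtLeast (a : ℝ) (x : UnitSphere d) : Set (UnitSphere d) :=
  {y | a ≤ inner ℝ (x : EuclideanSpace ℝ (Fin d)) (y : EuclideanSpace ℝ (Fin d))}

/-- The open solid sector over the cap `capAtLeast a x`: the cone over it inside the open unit
ball, without its apex. -/
def sector (a : ℝ) (x : UnitSphere d) : Set (EuclideanSpace ℝ (Fin d)) :=
  {z | 0 < ‖z‖ ∧ ‖z‖ < 1 ∧ a * ‖z‖ ≤ inner ℝ (x : EuclideanSpace ℝ (Fin d)) z}

theorem measurableSet_capAtLeast (a : ℝ) (x : UnitSphere d) :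
    MeasurableSet (capAtLeast a x) :=
  (isClosed_le continuous_const (by fun_prop)).measurableSet

theorem measurableSet_sector (a : ℝ) (x : UnitSphere d) : MeasurableSet (sector a x) := by
  refine MeasurableSet.inter ?_ (MeasurableSet.inter ?_ ?_)
  · exact (isOpen_lt continuous_const continuous_norm).measurableSet
  · exact (isOpen_lt continuous_norm continuous_const).measurableSet
  · exact (isClosed_le (f := fun z : EuclideanSpace ℝ (Fin d) => a * ‖z‖)
      (g := fun z => inner ℝ (x : EuclideanSpace ℝ (Fin d)) z)
      (by fun_prop) (by fun_prop)).measurableSet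

theorem Ioo_smul_image_capAtLeast (a : ℝ) (x : UnitSphere d) :
    Set.Ioo (0 : ℝ) 1 • ((↑) '' capAtLeast a x : Set (EuclideanSpace ℝ (Fin d))) =
      sector a x := by
  ext z
  rw [Set.mem_smul]
  constructor
  · rintro ⟨r, ⟨hr0, hr1⟩, _, ⟨y, hy, rfl⟩, rfl⟩
    have hn : ‖r • (y : EuclideanSpace ℝ (Fin d))‖ = r := by
      rw [norm_smul, norm_eq_of_mem_sphere y, mul_one, Real.norm_of_nonneg hr0.le]
    refine ⟨by rw [hn]; exact hr0, by rw [hn]; exact hr1, ?_⟩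
    rw [hn, real_inner_smul_right, mul_comm]
    exact mul_le_mul_of_nonneg_left hy hr0.le
  · rintro ⟨h0, h1, h2⟩
    have hn : ‖‖z‖⁻¹ • z‖ = 1 := by
      rw [norm_smul, norm_inv, norm_norm, inv_mul_cancel₀ h0.ne']
    refine ⟨‖z‖, ⟨h0, h1⟩, ‖z‖⁻¹ • z, ⟨⟨‖z‖⁻¹ • z, by simpa using hn⟩, ?_, rfl⟩, ?_⟩
    · change a ≤ inner ℝ (x : EuclideanSpace ℝ (Fin d)) (‖z‖⁻¹ • z)
      rw [real_inner_smul_right, inv_mul_eq_div, le_div_iff₀ h0]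
      exact h2
    · rw [smul_smul, mul_inv_cancel₀ h0.ne', one_smul]

theorem pos_of_unitSphere (x : UnitSphere d) : 0 < d := by
  rcases Nat.eq_zero_or_pos d with rfl | h
  · exact absurd (norm_eq_of_mem_sphere x)
      (by rw [Subsingleton.elim (x : EuclideanSpace ℝ (Fin 0)) 0, norm_zero]; exact zero_ne_one)
  · exact h

theorem unitBall_volume_pos (d : ℕ) :
    0 < (volume : Measure (EuclideanSpace ℝ (Fin d))).real (Metric.ball 0 1) :=
  ENNReal.toReal_pos (Metric.measure_ball_pos _ _ one_pos).ne' measure_ball_lt_top.ne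

theorem normalizedArea_capAtLeast (a : ℝ) (x : UnitSphere d) :
    normalizedArea (capAtLeast a x) =
      (volume : Measure (EuclideanSpace ℝ (Fin d))).real (sector a x) /
        (volume : Measure (EuclideanSpace ℝ (Fin d))).real (Metric.ball 0 1) := by
  have hd : (d : ℝ) ≠ 0 := by exact_mod_cast (pos_of_unitSphere x).ne'
  rw [normalizedArea, Measure.toSphere_real_apply_univ, measureReal_def,
    Measure.toSphere_apply' _ (measurableSet_capAtLeast a x), Ioo_smul_image_capAtLeast,
    finrank_euclideanSpace_fin, ENNReal.toReal_mul, ENNReal.toReal_natCast, ← measureReal_def,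
    mul_div_mul_left _ _ hd]

/-- All caps of the same angular radius have the same area: a reflection exchanges their
centres. -/
theorem normalizedArea_capAtLeast_eq (a : ℝ) (x y : UnitSphere d) :
    normalizedArea (capAtLeast a x) = normalizedArea (capAtLeast a y) := by
  rw [normalizedArea_capAtLeast, normalizedArea_capAtLeast]
  congr 1
  set e := (ℝ ∙ ((x : EuclideanSpace ℝ (Fin d)) - y))ᗮ.reflection
  have he : e x = y := by
    apply Submodule.reflection_sub
    rw [norm_eq_of_mem_sphere, norm_eq_of_mem_sphere]
  have hpre : e ⁻¹' sector a y = sector a x := by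
    ext z
    simp only [sector, Set.mem_preimage, Set.mem_ofPred_eq, LinearIsometryEquiv.norm_map, ← he,
      LinearIsometryEquiv.inner_map_map]
  rw [← hpre, measureReal_def, measureReal_def,
    e.measurePreserving.measure_preimage (measurableSet_sector a y).nullMeasurableSet]

theorem sector_subset_ball (a : ℝ) (x : UnitSphere d) : sector a x ⊆ Metric.ball 0 1 := by
  intro z hz
  simpa using hz.2.1

theorem volume_sector_ne_top (a : ℝ) (x : UnitSphere d) :
    (volume : Measure (EuclideanSpace ℝ (Fin d))) (sector a x) ≠ ⊤ :=
  ((measure_mono (sector_subset_ball a x)).trans_lt measure_ball_lt_top).ne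

theorem volume_real_smul_sector (a : ℝ) (x : UnitSphere d) {r : ℝ} (hr : 0 ≤ r) :
    (volume : Measure (EuclideanSpace ℝ (Fin d))).real (r • sector a x) =
      r ^ d * (volume : Measure (EuclideanSpace ℝ (Fin d))).real (sector a x) := by
  rw [measureReal_def, Measure.addHaar_smul_of_nonneg _ hr, finrank_euclideanSpace_fin,
    ENNReal.toReal_mul, ENNReal.toReal_ofReal (by positivity), ← measureReal_def]

theorem mem_smul_sector {a : ℝ} {x : UnitSphere d} {r : ℝ} (hr : 0 < r)
    {z : EuclideanSpace ℝ (Fin d)} (h0 : 0 < ‖z‖) (h1 : ‖z‖ < r)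
    (h2 : a * ‖z‖ ≤ inner ℝ (x : EuclideanSpace ℝ (Fin d)) z) : z ∈ r • sector a x := by
  rw [Set.mem_smul_set_iff_inv_smul_mem₀ hr.ne']
  have hn : ‖r⁻¹ • z‖ = r⁻¹ * ‖z‖ := by
    rw [norm_smul, norm_inv, Real.norm_of_nonneg hr.le]
  refine ⟨by rw [hn]; positivity, ?_, ?_⟩
  · rw [hn, inv_mul_eq_div, div_lt_one hr]; exact h1
  · rw [hn, real_inner_smul_right]
    have := mul_le_mul_of_nonneg_left h2 (inv_pos.mpr hr).le
    linarith

theorem norm_sub_smul_sq (x : UnitSphere d) (t : ℝ) (z : EuclideanSpace ℝ (Fin d)) :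
    ‖z - t • (x : EuclideanSpace ℝ (Fin d))‖ ^ 2 =
      ‖z‖ ^ 2 - 2 * t * inner ℝ (x : EuclideanSpace ℝ (Fin d)) z + t ^ 2 := by
  rw [norm_sub_sq_real, real_inner_smul_right, norm_smul, norm_eq_of_mem_sphere x,
    real_inner_comm, mul_one, Real.norm_eq_abs, sq_abs]
  ring

/-- Upper bound for the area of a cap: the part of the sector outside a smaller copy of it lies in
the ball that has the rim of the cap as a great sphere. -/
theorem normalizedArea_capAtLeast_le {a : ℝ} (ha0 : 0 < a) (ha1 : a < 1) (x : UnitSphere d) :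
    normalizedArea (capAtLeast a x) ≤ Real.sqrt (1 - a ^ 2) ^ d / (1 - a ^ 2) := by
  have hd := pos_of_unitSphere x
  have ha2 : a ^ 2 < 1 := by nlinarith
  have ha2' : 0 < a ^ 2 := by positivity
  set B := (volume : Measure (EuclideanSpace ℝ (Fin d))).real (Metric.ball 0 1) with hB
  have hBpos : 0 < B := unitBall_volume_pos d
  set V := (volume : Measure (EuclideanSpace ℝ (Fin d))).real (sector a x) with hV
  have hV0 : 0 ≤ V := measureReal_nonneg
  have hsub : sector a x \ (a ^ 2 • sector a x) ⊆
      Metric.closedBall (a • (x : EuclideanSpace ℝ (Fin d))) (Real.sqrt (1 - a ^ 2)) := by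
    rintro z ⟨⟨h0, h1, h2⟩, h3⟩
    have h4 : a ^ 2 ≤ ‖z‖ := by
      by_contra h
      exact h3 (mem_smul_sector ha2' h0 (not_le.mp h) h2)
    rw [Metric.mem_closedBall, dist_eq_norm]
    apply Real.le_sqrt_of_sq_le
    rw [norm_sub_smul_sq]
    have h5 := mul_le_mul_of_nonneg_left h2 ha0.le
    nlinarith
  have h1 : V ≤ (a ^ 2) ^ d * V + Real.sqrt (1 - a ^ 2) ^ d * B := by
    have hcb : (volume : Measure (EuclideanSpace ℝ (Fin d))).real
        (Metric.closedBall (a • (x : EuclideanSpace ℝ (Fin d))) (Real.sqrt (1 - a ^ 2))) =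
        Real.sqrt (1 - a ^ 2) ^ d * B := by
      rw [measureReal_def, Measure.addHaar_closedBall _ _ (Real.sqrt_nonneg _),
        finrank_euclideanSpace_fin, ENNReal.toReal_mul, ENNReal.toReal_ofReal (by positivity),
        ← measureReal_def]
    rw [← hcb, hV, ← volume_real_smul_sector a x ha2'.le]
    refine le_trans (measureReal_mono (s₂ := (a ^ 2 • sector a x) ∪ Metric.closedBall
      (a • (x : EuclideanSpace ℝ (Fin d))) (Real.sqrt (1 - a ^ 2))) ?_ ?_)
      (measureReal_union_le _ _)
    · intro z hz
      by_cases h : z ∈ a ^ 2 • sector a x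
      · exact Or.inl h
      · exact Or.inr (hsub ⟨hz, h⟩)
    · refine (measure_union_lt_top ?_ measure_closedBall_lt_top).ne
      rw [Measure.addHaar_smul_of_nonneg _ ha2'.le]
      exact ENNReal.mul_lt_top ENNReal.ofReal_lt_top (volume_sector_ne_top a x).lt_top
  have h2 : (a ^ 2) ^ d ≤ a ^ 2 := by
    calc (a ^ 2) ^ d ≤ (a ^ 2) ^ 1 := pow_le_pow_of_le_one ha2'.le ha2.le hd
      _ = a ^ 2 := pow_one _
  rw [normalizedArea_capAtLeast, ← hV, ← hB, div_le_div_iff₀ hBpos (by linarith)]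
  nlinarith

/-- Lower bound for the area of a cap: a slab of width `2 η` of a ball whose radius is that of
the rim of the cap lies in a slightly larger copy of the sector. -/
theorem le_normalizedArea_capAtLeast {a η : ℝ} (ha0 : 0 < a) (ha1 : a < 1) (hη : 0 < η)
    (hη' : η ^ 2 < 1 - a ^ 2) (x : UnitSphere d) :
    Real.sqrt (1 - a ^ 2) ^ d - 2 * Real.sqrt (1 - a ^ 2 - η ^ 2) ^ d ≤
      Real.sqrt (1 - a ^ 2 + (a + 2 * η) ^ 2) ^ d * normalizedArea (capAtLeast a x) := by
  have hd := pos_of_unitSphere x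
  have : Nonempty (Fin d) := ⟨⟨0, hd⟩⟩
  set B := (volume : Measure (EuclideanSpace ℝ (Fin d))).real (Metric.ball 0 1) with hB
  have hBpos : 0 < B := unitBall_volume_pos d
  set V := (volume : Measure (EuclideanSpace ℝ (Fin d))).real (sector a x) with hV
  set L := Real.sqrt (1 - a ^ 2 + (a + 2 * η) ^ 2) with hL
  have hLpos : 0 < L := Real.sqrt_pos.mpr (by nlinarith [sq_nonneg (a + 2 * η)])
  have hb : ∀ (z : EuclideanSpace ℝ (Fin d)) {r : ℝ}, 0 ≤ r →
      (volume : Measure (EuclideanSpace ℝ (Fin d))).real (Metric.ball z r) = r ^ d * B := by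
    intro z r hr
    rw [measureReal_def, Measure.addHaar_ball _ _ hr,
        finrank_euclideanSpace_fin, ENNReal.toReal_mul, ENNReal.toReal_ofReal (by positivity),
        ← measureReal_def]
  have hsub : Metric.ball ((a + η) • (x : EuclideanSpace ℝ (Fin d))) (Real.sqrt (1 - a ^ 2)) ⊆
      (L • sector a x ∪
        Metric.ball ((a + 2 * η) • (x : EuclideanSpace ℝ (Fin d)))
          (Real.sqrt (1 - a ^ 2 - η ^ 2))) ∪
        Metric.ball (a • (x : EuclideanSpace ℝ (Fin d))) (Real.sqrt (1 - a ^ 2 - η ^ 2)) := by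
    intro z hz
    rw [Metric.mem_ball, dist_eq_norm, Real.lt_sqrt (norm_nonneg _), norm_sub_smul_sq] at hz
    set p := inner ℝ (x : EuclideanSpace ℝ (Fin d)) z
    by_cases hp1 : a + 2 * η ≤ p
    · left; right
      rw [Metric.mem_ball, dist_eq_norm, Real.lt_sqrt (norm_nonneg _), norm_sub_smul_sq]
      nlinarith
    by_cases hp2 : p ≤ a
    · right
      rw [Metric.mem_ball, dist_eq_norm, Real.lt_sqrt (norm_nonneg _), norm_sub_smul_sq]
      nlinarith
    left; left
    rw [not_le] at hp1 hp2
    have hp : 0 < p := ha0.trans hp2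
    have hn : ‖z‖ ^ 2 < 1 - a ^ 2 + p ^ 2 := by nlinarith [sq_nonneg (a + η - p)]
    refine mem_smul_sector hLpos ?_ ?_ ?_
    · rw [norm_pos_iff]
      rintro rfl
      simp [p] at hp
    · apply Real.lt_sqrt_of_sq_lt
      nlinarith
    · apply le_of_sq_le_sq _ hp.le
      have h1 : a ^ 2 * ‖z‖ ^ 2 ≤ a ^ 2 * (1 - a ^ 2 + p ^ 2) :=
        mul_le_mul_of_nonneg_left hn.le (sq_nonneg a)
      have h2 : a ^ 2 ≤ p ^ 2 := by gcongr
      nlinarith [mul_nonneg (sub_nonneg.mpr h2) (show 0 ≤ 1 - a ^ 2 by nlinarith)]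
  have hfin : (volume : Measure (EuclideanSpace ℝ (Fin d))) (L • sector a x) < ⊤ := by
    rw [Measure.addHaar_smul_of_nonneg _ hLpos.le]
    exact ENNReal.mul_lt_top ENNReal.ofReal_lt_top (volume_sector_ne_top a x).lt_top
  have h1 := measureReal_mono (μ := (volume : Measure (EuclideanSpace ℝ (Fin d)))) hsub
    (measure_union_lt_top (measure_union_lt_top hfin measure_ball_lt_top)
      measure_ball_lt_top).ne
  have h2 := h1.trans (measureReal_union_le _ _)
  have h3 := h2.trans (add_le_add_left (measureReal_union_le _ _) _)
  rw [hb _ (Real.sqrt_nonneg _), hb _ (Real.sqrt_nonneg _), hb _ (Real.sqrt_nonneg _),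
    volume_real_smul_sector a x hLpos.le] at h3
  rw [normalizedArea_capAtLeast, ← hV, ← hB, ← mul_div_assoc, le_div_iff₀ hBpos]
  linarith

end CapArea

/-! ### Discretization of the sphere -/

section Discretization

variable {d : ℕ}

theorem normalizedArea_mono {A B : Set (UnitSphere d)} (h : A ⊆ B) :
    normalizedArea A ≤ normalizedArea B :=
  div_le_div_of_nonneg_right (measureReal_mono h) measureReal_nonneg

theorem normalizedArea_nonneg (A : Set (UnitSphere d)) : 0 ≤ normalizedArea A :=
  div_nonneg measureReal_nonneg measureReal_nonneg

theorem normalizedArea_univ (x : UnitSphere d) :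
    normalizedArea (Set.univ : Set (UnitSphere d)) = 1 := by
  have hd : (0 : ℝ) < d := by exact_mod_cast pos_of_unitSphere x
  rw [normalizedArea, div_self]
  rw [Measure.toSphere_real_apply_univ, finrank_euclideanSpace_fin]
  exact (mul_pos hd (unitBall_volume_pos d)).ne'

theorem capAtLeast_anti {a b : ℝ} (h : a ≤ b) (x : UnitSphere d) :
    capAtLeast b x ⊆ capAtLeast a x := fun _ hy => le_trans h hy

/-- The area of a cap is a continuous function of its angular radius, from above. -/
theorem exists_normalizedArea_capAtLeast_lt (a : ℝ) (x : UnitSphere d) {v : ℝ}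
    (hv : normalizedArea (capAtLeast a x) < v) :
    ∃ ε : ℝ, 0 < ε ∧ ∀ e ≤ ε, normalizedArea (capAtLeast (a - e) x) < v := by
  set μ := (volume : Measure (EuclideanSpace ℝ (Fin d))).toSphere
  have hanti : Antitone fun n : ℕ => capAtLeast (a - 1 / ((n : ℝ) + 1)) x := by
    intro m n hmn
    have : 1 / ((n : ℝ) + 1) ≤ 1 / ((m : ℝ) + 1) := by gcongr
    exact capAtLeast_anti (by linarith) x
  have hI : ⋂ n : ℕ, capAtLeast (a - 1 / ((n : ℝ) + 1)) x = capAtLeast a x := by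
    ext y
    rw [Set.mem_iInter]
    constructor
    · intro h
      have h1 : Tendsto (fun n : ℕ => a - 1 / ((n : ℝ) + 1)) atTop (𝓝 (a - 0)) :=
        tendsto_const_nhds.sub tendsto_one_div_add_atTop_nhds_zero_nat
      rw [sub_zero] at h1
      exact le_of_tendsto' h1 h
    · intro h n
      have : 0 < 1 / ((n : ℝ) + 1) := by positivity
      exact capAtLeast_anti (by linarith) x h
  have ht := tendsto_measure_iInter_atTop (μ := μ)
    (fun n : ℕ => (measurableSet_capAtLeast (a - 1 / ((n : ℝ) + 1)) x).nullMeasurableSet) hanti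
    ⟨0, measure_ne_top _ _⟩
  rw [hI] at ht
  have ht' := ((ENNReal.tendsto_toReal (measure_ne_top μ _)).comp ht).div_const (μ.real Set.univ)
  obtain ⟨n, hn⟩ := (ht'.eventually_lt_const hv).exists
  refine ⟨1 / ((n : ℝ) + 1), by positivity, fun e he => lt_of_le_of_lt ?_ hn⟩
  exact normalizedArea_mono (capAtLeast_anti (by linarith) x)

/-- A compact metric space can be rounded measurably to finitely many of its points. -/
theorem exists_simpleFunc_dist_lt (X : Type*) [MetricSpace X] [CompactSpace X] [Nonempty X]
    [MeasurableSpace X] [OpensMeasurableSpace X] {ε : ℝ} (hε : 0 < ε) :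
    ∃ g : SimpleFunc X X, ∀ y, dist (g y) y < ε := by
  set e := TopologicalSpace.denseSeq X
  have hcov : (Set.univ : Set X) ⊆ ⋃ n, Metric.ball (e n) ε := by
    intro y _
    obtain ⟨n, hn⟩ := (TopologicalSpace.denseRange_denseSeq X).exists_dist_lt y hε
    exact Set.mem_iUnion.mpr ⟨n, hn⟩
  obtain ⟨t, ht⟩ := isCompact_univ.elim_finite_subcover _ (fun _ => Metric.isOpen_ball) hcov
  refine ⟨SimpleFunc.nearestPt e (t.sup id), fun y => ?_⟩
  obtain ⟨n, hn, hy⟩ := Set.mem_iUnion₂.mp (ht (Set.mem_univ y))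
  have h1 := SimpleFunc.edist_nearestPt_le e y (Finset.le_sup (f := id) hn)
  rw [edist_dist, edist_dist, ENNReal.ofReal_le_ofReal_iff dist_nonneg] at h1
  rw [id, dist_comm (e n)] at h1
  exact lt_of_le_of_lt h1 hy

theorem sum_normalizedArea_preimage {ι : Type*} [Fintype ι] (g : UnitSphere d → ι)
    (hg : ∀ u, MeasurableSet (g ⁻¹' {u})) (P : ι → Prop) [DecidablePred P] :
    ∑ u with P u, normalizedArea (g ⁻¹' {u}) = normalizedArea {y | P (g y)} := by
  simp only [normalizedArea]
  rw [← Finset.sum_div, sum_measureReal_preimage_singleton _ fun u _ => hg u]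
  congr 2
  ext y
  simp

/-- Let `u` and `v` be unit vectors with `⟨v, u⟩ ≥ c`. The intersection of the cap around `v` with
`u` on its boundary and of the cap `⟨u, y⟩ ≥ c` around `u` lies in a cap around the midpoint
of `u` and `v`, of the radius obtained when `⟨v, u⟩ = c`. The defect `ε` leaves room
for rounding. -/
theorem exists_midpoint_cap {c ε : ℝ} (hc : 0 < c) (hε : 0 ≤ ε) (u v : UnitSphere d)
    (huv : c ≤ inner ℝ (v : EuclideanSpace ℝ (Fin d)) (u : EuclideanSpace ℝ (Fin d))) :
    ∃ m : UnitSphere d, ∀ y : UnitSphere d,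
      c - ε ≤ inner ℝ (u : EuclideanSpace ℝ (Fin d)) (y : EuclideanSpace ℝ (Fin d)) →
      inner ℝ (v : EuclideanSpace ℝ (Fin d)) (u : EuclideanSpace ℝ (Fin d)) - ε ≤
        inner ℝ (v : EuclideanSpace ℝ (Fin d)) (y : EuclideanSpace ℝ (Fin d)) →
      y ∈ capAtLeast (2 * c / Real.sqrt (2 + 2 * c) - 2 * ε) m := by
  set τ := inner ℝ (v : EuclideanSpace ℝ (Fin d)) (u : EuclideanSpace ℝ (Fin d)) with hτ
  have hn : ‖(v : EuclideanSpace ℝ (Fin d)) + u‖ = Real.sqrt (2 + 2 * τ) := by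
    rw [eq_comm, Real.sqrt_eq_iff_mul_self_eq (by linarith) (norm_nonneg _), ← sq,
      norm_add_sq_real, norm_eq_of_mem_sphere, norm_eq_of_mem_sphere]
    ring
  have hs1 : 1 ≤ Real.sqrt (2 + 2 * τ) := Real.one_le_sqrt.mpr (by linarith)
  have hs0 : 0 < Real.sqrt (2 + 2 * τ) := by linarith
  refine ⟨⟨(Real.sqrt (2 + 2 * τ))⁻¹ • ((v : EuclideanSpace ℝ (Fin d)) + u), ?_⟩, ?_⟩
  · rw [mem_sphere_zero_iff_norm, norm_smul, hn, norm_inv, Real.norm_of_nonneg hs0.le,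
      inv_mul_cancel₀ hs0.ne']
  intro y hu hv
  change _ ≤ inner ℝ ((Real.sqrt (2 + 2 * τ))⁻¹ • ((v : EuclideanSpace ℝ (Fin d)) + u))
    (y : EuclideanSpace ℝ (Fin d))
  rw [real_inner_smul_left, inner_add_left, inv_mul_eq_div]
  have h1 : 2 * c / Real.sqrt (2 + 2 * c) ≤ (c + τ) / Real.sqrt (2 + 2 * τ) := by
    apply le_of_sq_le_sq _ (div_nonneg (by linarith) hs0.le)
    rw [div_pow, div_pow, Real.sq_sqrt (by linarith), Real.sq_sqrt (by linarith),
      div_le_div_iff₀ (by linarith) (by linarith)]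
    have h3 : 0 ≤ 4 * c * (τ - c) + (τ - c) ^ 2 * (1 + c) := by
      have := mul_nonneg hc.le (sub_nonneg.mpr huv)
      positivity
    linarith
  have h2 : 2 * ε / Real.sqrt (2 + 2 * τ) ≤ 2 * ε := div_le_self (by linarith) hs1
  calc 2 * c / Real.sqrt (2 + 2 * c) - 2 * ε
      ≤ (c + τ) / Real.sqrt (2 + 2 * τ) - 2 * ε / Real.sqrt (2 + 2 * τ) := by linarith
    _ = (c + τ - 2 * ε) / Real.sqrt (2 + 2 * τ) := by ring
    _ ≤ _ := div_le_div_of_nonneg_right (by linarith) hs0.le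

theorem inner_sub_le_of_dist_le {ε : ℝ} (x y z : UnitSphere d) (h : dist y z ≤ ε) :
    inner ℝ (x : EuclideanSpace ℝ (Fin d)) (y : EuclideanSpace ℝ (Fin d)) - ε ≤
      inner ℝ (x : EuclideanSpace ℝ (Fin d)) (z : EuclideanSpace ℝ (Fin d)) := by
  have h1 := real_inner_le_norm (x : EuclideanSpace ℝ (Fin d))
    ((y : EuclideanSpace ℝ (Fin d)) - z)
  rw [norm_eq_of_mem_sphere, one_mul, ← dist_eq_norm, ← Subtype.dist_eq, inner_sub_right] at h1
  linarith

/-- The lower bound for `A(d, θ)` from the hard-core model at fugacity `l` on a fine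
discretization of the sphere. -/
theorem le_mul_maxCodeSize {θ : ℝ} (h0 : 0 < θ) (hpi : θ < Real.pi / 2) (x : UnitSphere d)
    {D Δ l k : ℝ} (hD : normalizedArea (capAtLeast (Real.cos θ) x) < D)
    (hΔ : normalizedArea
      (capAtLeast (2 * Real.cos θ / Real.sqrt (2 + 2 * Real.cos θ)) x) < Δ)
    (hl : 0 < l) (hlΔ : 2 * l * Δ < 1) :
    1 + k ≤ (Real.exp k / l + D / (1 - 2 * l * Δ)) * (maxCodeSize d θ : ℝ) := by
  classical
  set c := Real.cos θ with hc
  have hc0 : 0 < c := Real.cos_pos_of_mem_Ioo ⟨by linarith, hpi⟩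
  have hc1 : c < 1 := by
    have := Real.cos_lt_cos_of_nonneg_of_le_pi le_rfl (by linarith [Real.pi_pos] : θ ≤ Real.pi) h0
    simpa using this
  obtain ⟨ε₁, hε₁, hD'⟩ := exists_normalizedArea_capAtLeast_lt _ x hD
  obtain ⟨ε₂, hε₂, hΔ'⟩ := exists_normalizedArea_capAtLeast_lt _ x hΔ
  set ε := min ε₁ (ε₂ / 2)
  have hε : 0 < ε := lt_min hε₁ (by linarith)
  have hεε₁ : ε ≤ ε₁ := min_le_left _ _
  have hεε₂ : 2 * ε ≤ ε₂ := by linarith [min_le_right ε₁ (ε₂ / 2)]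
  have : Nonempty (UnitSphere d) := ⟨x⟩
  obtain ⟨g, hg⟩ := exists_simpleFunc_dist_lt (UnitSphere d) hε
  let g' : UnitSphere d → g.range := fun y => ⟨g y, g.mem_range_self y⟩
  have hg' : ∀ u, MeasurableSet (g' ⁻¹' {u}) := by
    intro u
    have : g' ⁻¹' {u} = g ⁻¹' {(u : UnitSphere d)} := by
      ext y; simp [g', Subtype.ext_iff]
    rw [this]
    exact g.measurableSet_preimage _
  let R : g.range → g.range → Prop := fun u v =>
    c < inner ℝ ((u : UnitSphere d) : EuclideanSpace ℝ (Fin d))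
      ((v : UnitSphere d) : EuclideanSpace ℝ (Fin d))
  have hr : ∀ u, R u u := by
    intro u
    change c < _
    rw [real_inner_self_eq_norm_sq, norm_eq_of_mem_sphere]
    linarith
  have hs : ∀ u v, R u v → R v u := by
    intro u v h
    change c < _
    rw [real_inner_comm]
    exact h
  refine one_add_le_mul_of_independent_card_le hr hs (w := fun u => normalizedArea (g' ⁻¹' {u}))
    (fun u => normalizedArea_nonneg _) ?_ hl hlΔ ?_ ?_ ?_
  · have := sum_normalizedArea_preimage g' hg' (fun _ => True)
    simpa [normalizedArea_univ x] using this
  · intro v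
    rw [sum_normalizedArea_preimage g' hg']
    refine le_trans (normalizedArea_mono (B := capAtLeast (c - ε) v) ?_) ?_
    · intro y hy
      have h1 : c < _ := hy
      have h2 := inner_sub_le_of_dist_le (v : UnitSphere d) (g y) y (hg y).le
      exact le_trans (sub_le_sub_right h1.le ε) h2
    · rw [normalizedArea_capAtLeast_eq _ _ x]
      exact (hD' ε hεε₁).le
  · intro v
    refine ⟨fun u => inner ℝ ((v : UnitSphere d) : EuclideanSpace ℝ (Fin d))
      ((u : UnitSphere d) : EuclideanSpace ℝ (Fin d)), fun u huv => ?_⟩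
    rw [sum_normalizedArea_preimage g' hg']
    obtain ⟨m, hm⟩ := exists_midpoint_cap hc0 hε.le (u : UnitSphere d) (v : UnitSphere d) huv.le
    refine le_trans (normalizedArea_mono (fun y hy => hm y ?_ ?_)) ?_
    · have h1 : c < _ := hy.2.1
      have h2 := inner_sub_le_of_dist_le (u : UnitSphere d) (g y) y (hg y).le
      exact le_trans (sub_le_sub_right h1.le ε) h2
    · have h2 := inner_sub_le_of_dist_le (v : UnitSphere d) (g y) y (hg y).le
      exact le_trans (sub_le_sub_right hy.2.2 ε) h2
    · rw [normalizedArea_capAtLeast_eq _ _ x]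
      exact (hΔ' (2 * ε) hεε₂).le
  · intro I hI
    have hcode : IsSphericalCode θ (I.map (Function.Embedding.subtype _)) := by
      intro y hy z hz hyz
      rw [Finset.mem_map] at hy hz
      obtain ⟨u, hu, rfl⟩ := hy
      obtain ⟨v, hv, rfl⟩ := hz
      exact not_lt.mp (hI u hu v hv fun h => hyz (by rw [h]))
    have := (isGreatest_maxCodeSize d h0 (by linarith [Real.pi_pos])).2
      ⟨_, hcode, rfl⟩
    rw [Finset.card_map] at this
    exact_mod_cast this

end Discretization

/-! ### Asymptotics in the dimension -/

section Asymptotics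

/-- To exponential order, the area of a cap in dimension `d` is at least the `d`-th power of the
radius of its rim. -/
theorem eventually_le_log_normalizedArea {a β : ℝ} (ha0 : 0 < a) (ha1 : a < 1) (hβ : 0 < β) :
    ∀ᶠ d : ℕ in atTop, ∀ x : UnitSphere d, 0 < normalizedArea (capAtLeast a x) ∧
      (d : ℝ) * (Real.log (Real.sqrt (1 - a ^ 2)) - β) ≤
        Real.log (normalizedArea (capAtLeast a x)) := by
  have ha2 : 0 < 1 - a ^ 2 := by nlinarith
  set r := Real.sqrt (1 - a ^ 2) with hr
  have hrpos : 0 < r := Real.sqrt_pos.mpr ha2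
  obtain ⟨η, hη, hη1, hη2⟩ : ∃ η : ℝ, 0 < η ∧ η ^ 2 < 1 - a ^ 2 ∧
      Real.log (Real.sqrt (1 - a ^ 2 + (a + 2 * η) ^ 2)) < β / 2 := by
    have h1 : Tendsto (fun η : ℝ => η ^ 2) (𝓝[>] 0) (𝓝 0) := by
      have : ContinuousAt (fun η : ℝ => η ^ 2) 0 := by fun_prop
      simpa using this.tendsto.mono_left nhdsWithin_le_nhds
    have h2 : Tendsto (fun η : ℝ => Real.log (Real.sqrt (1 - a ^ 2 + (a + 2 * η) ^ 2)))
        (𝓝[>] 0) (𝓝 0) := by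
      have : ContinuousAt
          (fun η : ℝ => Real.log (Real.sqrt (1 - a ^ 2 + (a + 2 * η) ^ 2))) 0 := by
        refine ContinuousAt.log (by fun_prop) ?_
        simp
      simpa using this.tendsto.mono_left nhdsWithin_le_nhds
    obtain ⟨η, hη, hη1, hη2⟩ := ((eventually_mem_nhdsWithin (s := Set.Ioi (0 : ℝ))).and
      ((h1.eventually_lt_const ha2).and (h2.eventually_lt_const (half_pos hβ)))).exists
    exact ⟨η, hη, hη1, hη2⟩
  set L := Real.sqrt (1 - a ^ 2 + (a + 2 * η) ^ 2) with hL
  have hLpos : 0 < L := Real.sqrt_pos.mpr (by positivity)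
  set t := Real.sqrt (1 - a ^ 2 - η ^ 2) with ht
  have htr : t / r < 1 := by
    rw [div_lt_one hrpos]
    exact Real.sqrt_lt_sqrt (by linarith) (by nlinarith)
  have hpow := (tendsto_pow_atTop_nhds_zero_of_lt_one
    (div_nonneg (Real.sqrt_nonneg _) hrpos.le) htr).eventually_le_const
      (show (0 : ℝ) < 1 / 4 by norm_num)
  have hlin : ∀ᶠ d : ℕ in atTop, Real.log 2 / (β / 2) ≤ (d : ℝ) :=
    tendsto_natCast_atTop_atTop.eventually_ge_atTop _
  filter_upwards [hpow, hlin] with d hd1 hd2 x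
  rw [div_pow, div_le_iff₀ (by positivity)] at hd1
  rw [div_le_iff₀ (by positivity)] at hd2
  have h := le_normalizedArea_capAtLeast ha0 ha1 hη hη1 x
  rw [← hr, ← ht, ← hL] at h
  have hLd : 0 < L ^ d := by positivity
  have hrd : 0 < r ^ d := by positivity
  have hs : r ^ d / (2 * L ^ d) ≤ normalizedArea (capAtLeast a x) := by
    rw [div_le_iff₀ (by positivity)]
    linarith
  refine ⟨lt_of_lt_of_le (by positivity) hs, ?_⟩
  have hlog := Real.log_le_log (by positivity) hs
  rw [Real.log_div hrd.ne' (by positivity), Real.log_mul two_ne_zero hLd.ne', Real.log_pow,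
    Real.log_pow] at hlog
  have : (d : ℝ) * Real.log L ≤ d * (β / 2) :=
    mul_le_mul_of_nonneg_left hη2.le (Nat.cast_nonneg d)
  linarith

theorem tendsto_log_mul_sq_div {K : ℝ} (hK : 0 < K) :
    Tendsto (fun d : ℕ => Real.log (K * (d : ℝ) ^ 2) / d) atTop (𝓝 0) := by
  have h1 : Tendsto (fun x : ℝ => Real.log x / x) atTop (𝓝 0) :=
    Real.isLittleO_log_id_atTop.tendsto_div_nhds_zero
  have h2 : Tendsto (fun d : ℕ => Real.log K / d + 2 * (Real.log (d : ℝ) / d)) atTop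
      (𝓝 (0 + 2 * 0)) :=
    (tendsto_const_nhds.div_atTop tendsto_natCast_atTop_atTop).add
      ((h1.comp tendsto_natCast_atTop_atTop).const_mul 2)
  rw [mul_zero, add_zero] at h2
  refine h2.congr' ?_
  filter_upwards [eventually_gt_atTop 0] with d hd
  have : (d : ℝ) ≠ 0 := by exact_mod_cast hd.ne'
  rw [Real.log_mul hK.ne' (pow_ne_zero 2 this), Real.log_pow]
  push_cast
  ring

/-- The lower bound for `A(d, θ)`, with the constant expressed by the rim radii `√(1 - a²)` of a
cap of angular radius `θ` and `√(1 - b²)` of the cap that covers the intersection of two such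
caps centred on each other's boundary. -/
theorem eventually_le_maxCodeSize_mul {θ β : ℝ} (h0 : 0 < θ) (hpi : θ < Real.pi / 2)
    {b : ℝ} (hb : b = 2 * Real.cos θ / Real.sqrt (2 + 2 * Real.cos θ)) (hb0 : 0 < b) (hb1 : b < 1)
    (hβ : β < Real.log (Real.sqrt (1 - Real.cos θ ^ 2) / Real.sqrt (1 - b ^ 2))) :
    ∀ᶠ d : ℕ in atTop, ∀ x : UnitSphere d,
      0 < normalizedArea (capAtLeast (Real.cos θ) x) ∧
      β ≤ maxCodeSize d θ * normalizedArea (capAtLeast (Real.cos θ) x) / d := by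
  set a := Real.cos θ with ha
  have ha0 : 0 < a := Real.cos_pos_of_mem_Ioo ⟨by linarith, hpi⟩
  have ha1 : a < 1 := by
    have := Real.cos_lt_cos_of_nonneg_of_le_pi le_rfl (by linarith [Real.pi_pos] : θ ≤ Real.pi) h0
    simpa using this
  have hb2 : 0 < 1 - b ^ 2 := by nlinarith
  have ha2 : 0 < 1 - a ^ 2 := by nlinarith
  set ρ := Real.sqrt (1 - b ^ 2) with hρ
  set r := Real.sqrt (1 - a ^ 2) with hr
  have hρpos : 0 < ρ := Real.sqrt_pos.mpr hb2
  have hrpos : 0 < r := Real.sqrt_pos.mpr ha2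
  set C := Real.log (r / ρ) with hC
  have hCeq : C = Real.log r - Real.log ρ := Real.log_div hrpos.ne' hρpos.ne'
  set γ := (C - β) / 2 with hγ
  have hγpos : 0 < γ := by rw [hγ]; linarith
  set K := 2 / (1 - b ^ 2) with hK
  have hKpos : 0 < K := by positivity
  have hinv : Tendsto (fun d : ℕ => (1 : ℝ) / d) atTop (𝓝 0) := tendsto_one_div_atTop_nhds_zero_nat
  have hlim : Tendsto (fun d : ℕ => ((1 : ℝ) / d + (C - γ) - Real.log (K * (d : ℝ) ^ 2) / d) /
      ((1 + 1 / (d : ℝ)) * (1 / d + 1 / (1 - 2 * (1 / d))))) atTop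
      (𝓝 ((0 + (C - γ) - 0) / ((1 + 0) * (0 + 1 / (1 - 2 * 0))))) := by
    refine Tendsto.div ((hinv.add_const _).sub (tendsto_log_mul_sq_div hKpos))
      ((hinv.const_add 1).mul (hinv.add (Tendsto.div tendsto_const_nhds
        ((hinv.const_mul 2).const_sub 1) (by norm_num)))) (by norm_num)
  have hβ' : β < (0 + (C - γ) - 0) / ((1 + 0) * (0 + 1 / (1 - 2 * 0))) := by
    norm_num
    rw [hγ]
    linarith
  filter_upwards [hlim.eventually_const_lt hβ', eventually_le_log_normalizedArea ha0 ha1 hγpos,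
    eventually_ge_atTop 3] with d hd1 hd2 hd3 x
  obtain ⟨hspos, hslog⟩ := hd2 x
  refine ⟨hspos, hd1.le.trans ?_⟩
  have hd3' : (3 : ℝ) ≤ d := by exact_mod_cast hd3
  have hdpos : (0 : ℝ) < d := by linarith
  set s := normalizedArea (capAtLeast a x) with hs
  have hρd : 0 < ρ ^ d := by positivity
  -- an upper bound for the area of the covering caps, with a factor `2` to spare
  set U := K * ρ ^ d with hU
  have hUpos : 0 < U := by positivity
  have hUlt : normalizedArea (capAtLeast b x) < U := by
    refine lt_of_le_of_lt (normalizedArea_capAtLeast_le hb0 hb1 x) ?_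
    rw [hU, hK, ← hρ, div_mul_eq_mul_div]
    apply div_lt_div_of_pos_right _ hb2
    linarith
  set D := s * (1 + 1 / d) with hD
  have hDlt : s < D := by
    have : 0 < s * (1 / d) := by positivity
    rw [hD]; linarith
  have hDpos : 0 < D := hspos.trans hDlt
  -- the fugacity at which local clusters are still negligible
  set l := 1 / (d * U) with hl
  have hlpos : 0 < l := by positivity
  have hlU : 2 * l * U = 2 * (1 / d) := by rw [hl]; field_simp
  have h1d : 2 * (1 / (d : ℝ)) < 1 := by
    rw [mul_one_div, div_lt_one hdpos]; linarith
  rw [hb] at hUlt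
  have key := le_mul_maxCodeSize (k := Real.log (l * D / d)) h0 hpi x hDlt hUlt hlpos
    (by rw [hlU]; exact h1d)
  rw [Real.exp_log (by positivity), hlU] at key
  have hcoef : l * D / d / l + D / (1 - 2 * (1 / d)) =
      s * ((1 + 1 / (d : ℝ)) * (1 / d + 1 / (1 - 2 * (1 / d)))) := by
    have : (1 - 2 * (1 / (d : ℝ))) ≠ 0 := by linarith
    have e1 : l * D / d / l = D * (1 / d) := by field_simp
    rw [e1, hD]; ring
  rw [hcoef] at key
  have hk : d * (C - γ) - Real.log (K * (d : ℝ) ^ 2) ≤ Real.log (l * D / d) := by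
    have e2 : s / (K * (d : ℝ) ^ 2 * ρ ^ d) ≤ l * D / d := by
      have e3 : l * D / d = D / (K * (d : ℝ) ^ 2 * ρ ^ d) := by
        rw [hl, hU]; field_simp
      rw [e3]
      exact div_le_div_of_nonneg_right hDlt.le (by positivity)
    have e4 := Real.log_le_log (by positivity) e2
    rw [Real.log_div hspos.ne' (by positivity), Real.log_mul (by positivity) hρd.ne',
      Real.log_pow] at e4
    rw [hCeq]
    linarith
  have hden : 0 < (1 + 1 / (d : ℝ)) * (1 / d + 1 / (1 - 2 * (1 / d))) := by
    have : 0 < 1 - 2 * (1 / (d : ℝ)) := by linarith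
    positivity
  rw [div_le_iff₀ hden]
  have e5 : (1 : ℝ) / d + (C - γ) - Real.log (K * (d : ℝ) ^ 2) / d =
      (1 + (d * (C - γ) - Real.log (K * (d : ℝ) ^ 2))) / d := by field_simp; ring
  rw [e5, div_mul_eq_mul_div ((maxCodeSize d θ : ℝ) * s)]
  apply div_le_div_of_nonneg_right _ hdpos.le
  linarith

/-- `sin (q θ)` is the rim radius of the cap around the midpoint of two points at angle `θ` that
covers the intersection of the caps of angular radius `θ` around them. -/
theorem sin_q {θ : ℝ} (h0 : 0 < θ) (hpi : θ < Real.pi / 2) :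
    Real.sin (q θ) =
      Real.sqrt ((1 - Real.cos θ) ^ 2 * (1 + 2 * Real.cos θ)) / Real.sin θ ∧
    Real.sin (q θ) =
      Real.sqrt (1 - (2 * Real.cos θ / Real.sqrt (2 + 2 * Real.cos θ)) ^ 2) := by
  have ha0 : 0 < Real.cos θ := Real.cos_pos_of_mem_Ioo ⟨by linarith, hpi⟩
  have hsin : 0 < Real.sin θ := Real.sin_pos_of_pos_of_lt_pi h0 (by linarith)
  have hsq := Real.sin_sq_add_cos_sq θ
  have heq : Real.sqrt ((Real.cos θ - 1) ^ 2 * (1 + 2 * Real.cos θ)) / Real.sin θ =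
      Real.sqrt (1 - (2 * Real.cos θ / Real.sqrt (2 + 2 * Real.cos θ)) ^ 2) := by
    rw [div_eq_iff hsin.ne']
    nth_rewrite 1 [← Real.sqrt_sq hsin.le]
    rw [← Real.sqrt_mul' _ (sq_nonneg _), div_pow, Real.sq_sqrt (by linarith)]
    congr 1
    have h1 : Real.sin θ ^ 2 = (1 - Real.cos θ) * (1 + Real.cos θ) := by linarith
    have h2 : 2 + 2 * Real.cos θ ≠ 0 := by linarith
    rw [h1]
    field_simp
    ring
  have hle : Real.sqrt (1 - (2 * Real.cos θ / Real.sqrt (2 + 2 * Real.cos θ)) ^ 2) ≤ 1 :=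
    Real.sqrt_le_one.mpr (by linarith [sq_nonneg (2 * Real.cos θ / Real.sqrt (2 + 2 * Real.cos θ))])
  have hq : Real.sin (q θ) =
      Real.sqrt ((Real.cos θ - 1) ^ 2 * (1 + 2 * Real.cos θ)) / Real.sin θ := by
    rw [q, Real.sin_arcsin]
    · exact le_trans (by norm_num) (div_nonneg (Real.sqrt_nonneg _) hsin.le)
    · rw [heq]; exact hle
  refine ⟨?_, hq.trans heq⟩
  rw [hq]
  congr 3
  ring

end Asymptotics

end SphericalCode

theorem theorem2 (θ : ℝ) (hθ : θ ∈ Set.Ioo 0 (Real.pi / 2)) :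
    0 < SphericalCode.codeConst θ ∧
    SphericalCode.codeConst θ =
      Real.log (Real.sin θ ^ 2 /
        Real.sqrt ((1 - Real.cos θ) ^ 2 * (1 + 2 * Real.cos θ))) ∧
    ∃ δ : ℕ → ℝ, Tendsto δ atTop (𝓝 0) ∧
      ∀ᶠ d : ℕ in atTop, ∀ x : SphericalCode.UnitSphere d,
        (1 + δ d) * (SphericalCode.codeConst θ * (d : ℝ) /
            SphericalCode.normalizedArea (SphericalCode.cap θ x)) ≤
          (SphericalCode.maxCodeSize d θ : ℝ) := by
  obtain ⟨h0, hpi⟩ := hθ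
  have ha0 : 0 < Real.cos θ := Real.cos_pos_of_mem_Ioo ⟨by linarith, hpi⟩
  have ha1 : Real.cos θ < 1 := by
    have := Real.cos_lt_cos_of_nonneg_of_le_pi le_rfl (by linarith [Real.pi_pos] : θ ≤ Real.pi) h0
    simpa using this
  have hsin : 0 < Real.sin θ := Real.sin_pos_of_pos_of_lt_pi h0 (by linarith)
  obtain ⟨hq1, hq2⟩ := SphericalCode.sin_q h0 hpi
  set b := 2 * Real.cos θ / Real.sqrt (2 + 2 * Real.cos θ) with hb
  have hsqrt : 0 < Real.sqrt (2 + 2 * Real.cos θ) := Real.sqrt_pos.mpr (by linarith)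
  have hb0 : 0 < b := by positivity
  have hab : Real.cos θ < b := by
    rw [hb, lt_div_iff₀ hsqrt, mul_comm]
    apply mul_lt_mul_of_pos_right _ ha0
    rw [Real.sqrt_lt' two_pos]
    linarith
  have hb1 : b < 1 := by
    rw [hb, div_lt_one hsqrt, Real.lt_sqrt (by linarith)]
    nlinarith
  have hρpos : 0 < Real.sqrt (1 - b ^ 2) := Real.sqrt_pos.mpr (by nlinarith)
  have hsin' : Real.sin θ = Real.sqrt (1 - Real.cos θ ^ 2) := by
    rw [← Real.sin_sq, Real.sqrt_sq hsin.le]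
  have hconst : SphericalCode.codeConst θ =
      Real.log (Real.sqrt (1 - Real.cos θ ^ 2) / Real.sqrt (1 - b ^ 2)) := by
    rw [SphericalCode.codeConst, hq2, hsin']
  have hpos : 0 < SphericalCode.codeConst θ := by
    rw [hconst]
    apply Real.log_pos
    rw [one_lt_div hρpos]
    apply Real.sqrt_lt_sqrt <;> nlinarith
  refine ⟨hpos, ?_, ?_⟩
  · rw [SphericalCode.codeConst, hq1, div_div_eq_mul_div, sq (Real.sin θ)]
  set C := SphericalCode.codeConst θ with hC
  -- all caps have the same area, so the supremum is only a name for the common value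
  set s : ℕ → ℝ := fun d => ⨆ x : SphericalCode.UnitSphere d,
    SphericalCode.normalizedArea (SphericalCode.cap θ x) with hsdef
  have hs : ∀ (d : ℕ) (x : SphericalCode.UnitSphere d),
      s d = SphericalCode.normalizedArea (SphericalCode.cap θ x) := by
    intro d x
    have : Nonempty (SphericalCode.UnitSphere d) := ⟨x⟩
    have h : ∀ y : SphericalCode.UnitSphere d,
        SphericalCode.normalizedArea (SphericalCode.cap θ y) =
          SphericalCode.normalizedArea (SphericalCode.cap θ x) := fun y =>
      SphericalCode.normalizedArea_capAtLeast_eq (Real.cos θ) y x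
    simp only [hsdef, h, ciSup_const]
  have hev : ∀ β < C, ∀ᶠ d : ℕ in atTop, ∀ x : SphericalCode.UnitSphere d,
      0 < s d ∧ β ≤ SphericalCode.maxCodeSize d θ * s d / d := by
    intro β hβ
    filter_upwards [SphericalCode.eventually_le_maxCodeSize_mul h0 hpi hb hb0 hb1
      (hconst ▸ hβ)] with d hd x
    rw [hs d x]
    exact hd x
  refine ⟨fun d => min 0 (SphericalCode.maxCodeSize d θ * s d / d / C - 1), ?_, ?_⟩
  · rw [tendsto_order]
    refine ⟨fun t ht => ?_, fun t ht => ?_⟩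
    · filter_upwards [hev ((1 + t / 2) * C) (by nlinarith), eventually_gt_atTop 0] with d hd hd0
      have x : SphericalCode.UnitSphere d :=
        ⟨EuclideanSpace.single ⟨0, hd0⟩ 1, by simp⟩
      refine lt_min ht ?_
      have := (le_div_iff₀ hpos).mpr (hd x).2
      linarith
    · exact Eventually.of_forall fun d => lt_of_le_of_lt (min_le_left _ _) ht
  · filter_upwards [hev 0 hpos, eventually_gt_atTop 0] with d hd hd0 x
    have hspos := (hd x).1
    have hdpos : (0 : ℝ) < d := by exact_mod_cast hd0
    rw [← hs d x]
    calc (1 + min 0 (SphericalCode.maxCodeSize d θ * s d / d / C - 1)) * (C * d / s d)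
        ≤ (SphericalCode.maxCodeSize d θ * s d / d / C) * (C * d / s d) := by
          apply mul_le_mul_of_nonneg_right _ (by positivity)
          linarith [min_le_right 0 (SphericalCode.maxCodeSize d θ * s d / d / C - 1)]
      _ = SphericalCode.maxCodeSize d θ := by field_simp
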